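/- Let $d\in\{2,3\}$, let $\mathcal D\subset\mathbb R^d$ be a bounded open set, and let $H_0^1(\mathcal D)=H_0^1(\mathcal D;\mathbb C)$ carry the inner product $(v,w)_{H_0^1}=\int_{\mathcal D}\nabla\overline v\cdot\nabla w\,dr$ and the norm $\|v\|_{H_0^1}=\|\nabla v\|_{L^2}$. Let $V\in L^\infty(\mathcal D)$ with $V\ge 0$, let $\beta\ge 0$ and $\Omega\ge 0$, and assume that for some $K>0$ $$V(r)\ \ge\ \frac{1+K}{4}\,\Omega^2(x^2+y^2)\qquad\text{for a.e. } r\in\mathcal D,$$ where $x,y$ are the first two coordinates of $r$. Put $L_z=-\mathrm i(x\partial_y-y\partial_x)$ and, for $u\in H_0^1(\mathcal D)$, $$E(u)=\int_{\mathcal D}\Big(\tfrac12|\nabla u|^2+\tfrac12V|u|^2+\tfrac{\beta}{4}|u|^4-\tfrac{\Omega}{2}\,\overline u\,L_zu\Big)dr .$$ Let $\mathcal M=\{u\in H_0^1(\mathcal D):\|u\|_{L^2}=1\}$. Let $\nabla_{H_0^1}E(u)\in H_0^1(\mathcal D)$ be defined by $\Re(\nabla_{H_0^1}E(u),h)_{H_0^1}=\langle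 E'(u),h\rangle$ for all $h\in H_0^1(\mathcal D)$, where $E'(u)$ is the real Fréchet derivative of $E$. Let $\mathcal G u\in H_0^1(\mathcal D)$ be defined by $(\mathcal G u,h)_{H_0^1}=(u,h)_{L^2}=\int_{\mathcal D}\overline u\,h\,dr$ for all $h\in H_0^1(\mathcal D)$. For $u\in\mathcal M$ let $$\nabla^{\mathcal R}_{H_0^1}E(u)=\nabla_{H_0^1}E(u)-\frac{\Re(\nabla_{H_0^1}E(u),\mathcal G u)_{H_0^1}}{\|\mathcal G u\|_{H_0^1}^2}\,\mathcal G u ,$$ and let $R(v)=v/\|v\|_{L^2}$ for $v\ne0$. **Theorem (energy dissipation for the $H_0^1$ scheme).** There are positive constants $C_u,C_g,C_\alpha$ with $C_\alpha\le 1$, depending only on $\mathcal D,d,\beta,V,\Omega$ and $\|u_0\|_{H_0^1}$, such that the following holds for every $u_0\in\mathcal M$ with the given norm $\|u_0\|_{H_0^1}$, for all $\alpha_{\min},\alpha_{\max}$ and every sequence $\{\alpha_n\}_{n\ge0}$ with $0<\alpha_{\min}\le\alpha_n\le\alpha_{\max}\le C_\alpha$ for all $n$, and for the sequence generated by $$u_{n+1}=R\big(u_n-\alpha_n\nabla^{\mathcal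 R}_{H_0^1}E(u_n)\big).$$ For all $n\ge 0$: 1. $\|u_n\|_{H_0^1}\le C_u$; 2. $\|\nabla^{\mathcal R}_{H_0^1}E(u_n)\|_{H_0^1}\le\|\nabla_{H_0^1}E(u_n)\|_{H_0^1}\le C_g$; 3. $E(u_n)-E(u_{n+1})\ge\dfrac{\alpha_{\min}}{2}\,\|\nabla^{\mathcal R}_{H_0^1}E(u_n)\|_{H_0^1}^2$. -/

import Mathlib

open MeasureTheory
open scoped ContDiff ComplexConjugate

noncomputable section

namespace GrossPitaevskii

/-- Points of physical space `ℝᵈ`. -/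
abbrev Space (d : ℕ) : Type := EuclideanSpace ℝ (Fin d)

/-- The complex Lebesgue space `L²(D; ℂ)`. -/
abbrev L2 {d : ℕ} (D : Set (Space d)) : Type :=
  Lp ℂ 2 (volume.restrict D)

/-- The space `L²(D; ℂᵈ)` of square integrable complex vector fields. -/
abbrev L2Field {d : ℕ} (D : Set (Space d)) : Type :=
  Lp (EuclideanSpace ℂ (Fin d)) 2 (volume.restrict D)

/-- The Hilbert space `L²(D; ℂ) × L²(D; ℂᵈ)`; the map `u ↦ (u, ∇u)` embeds `H¹(D; ℂ)` with
its usual norm `(‖u‖² + ‖∇u‖²)^(1/2)` isometrically into it. -/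
abbrev L2Pair {d : ℕ} (D : Set (Space d)) : Type :=
  WithLp 2 (L2 D × L2Field D)

/-- `φ ∈ C_c^∞(D; ℂ)`. -/
structure IsTestFunction {d : ℕ} (D : Set (Space d)) (φ : Space d → ℂ) : Prop where
  smooth : ContDiff ℝ ∞ φ
  compact : HasCompactSupport φ
  support_subset : tsupport φ ⊆ D

/-- The classical partial derivative `∂ᵢ φ`. -/
def partialDeriv {d : ℕ} (i : Fin d) (φ : Space d → ℂ) (x : Space d) : ℂ :=
  fderiv ℝ φ x (EuclideanSpace.single i 1)

/-- The classical gradient `∇φ = (∂ᵢ φ)ᵢ`. -/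
def classicalGrad {d : ℕ} (φ : Space d → ℂ) (x : Space d) : EuclideanSpace ℂ (Fin d) :=
  WithLp.toLp 2 fun i => partialDeriv i φ x

/-- The pairs `(φ, ∇φ)` with `φ ∈ C_c^∞(D; ℂ)`. -/
def testPairs {d : ℕ} (D : Set (Space d)) : Set (L2Pair D) :=
  {p | ∃ φ : Space d → ℂ, IsTestFunction D φ ∧
    p.fst =ᵐ[volume.restrict D] φ ∧ p.snd =ᵐ[volume.restrict D] classicalGrad φ}

/-- The closure of the pairs `(φ, ∇φ)`, `φ ∈ C_c^∞(D; ℂ)`, as a complex linear subspace. -/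
def h01Submodule {d : ℕ} (D : Set (Space d)) : Submodule ℂ (L2Pair D) :=
  (Submodule.span ℂ (testPairs D)).topologicalClosure

/-- `H₀¹(D; ℂ)`: the closure of `C_c^∞(D; ℂ)` in the `H¹` norm. An element `u` is stored as the
pair `(u, ∇u)`; see `H01.hasWeakGradient` and `H01.ext_toL2` below: the second component is the
weak gradient of the first one, and `u` is determined by its first component. -/
abbrev H01 {d : ℕ} (D : Set (Space d)) : Type := h01Submodule D

namespace H01

variable {d : ℕ} {D : Set (Space d)}

/-- The underlying function of `u ∈ H₀¹(D)`. -/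
def toL2 (u : H01 D) : L2 D := (u : L2Pair D).fst

/-- The weak gradient `∇u` of `u ∈ H₀¹(D)`. -/
def grad (u : H01 D) : L2Field D := (u : L2Pair D).snd

/-- The inner product `(v, w)_{H₀¹} = ∫_D ∇v̄ · ∇w`. -/
def innerH (v w : H01 D) : ℂ := inner ℂ v.grad w.grad

/-- The norm `‖u‖_{H₀¹} = ‖∇u‖_{L²}`. -/
def normH (u : H01 D) : ℝ := ‖u.grad‖

/-- The norm `‖u‖_{L²}`. -/
def normL2 (u : H01 D) : ℝ := ‖u.toL2‖

end H01

/-- `g` is the weak gradient of `u` on `D`. -/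
def HasWeakGradient {d : ℕ} (D : Set (Space d)) (u : Space d → ℂ)
    (g : Space d → EuclideanSpace ℂ (Fin d)) : Prop :=
  ∀ φ : Space d → ℂ, IsTestFunction D φ → ∀ i : Fin d,
    ∫ x in D, u x * partialDeriv i φ x = -∫ x in D, g x i * φ x

section Helpers

variable {d : ℕ} {D : Set (Space d)}

theorem IsTestFunction.continuous_partialDeriv {φ : Space d → ℂ} (hφ : IsTestFunction D φ)
    (i : Fin d) : Continuous (partialDeriv i φ) :=
  (hφ.smooth.continuous_fderiv (by simp)).clm_apply continuous_const

theorem IsTestFunction.compact_partialDeriv {φ : Space d → ℂ} (hφ : IsTestFunction D φ)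
    (i : Fin d) : HasCompactSupport (partialDeriv i φ) :=
  hφ.compact.fderiv_apply (𝕜 := ℝ) (EuclideanSpace.single i 1)

theorem IsTestFunction.eq_zero {φ : Space d → ℂ} (hφ : IsTestFunction D φ)
    {x : Space d} (hx : x ∉ D) : φ x = 0 :=
  image_eq_zero_of_notMem_tsupport fun h => hx (hφ.support_subset h)

theorem IsTestFunction.partialDeriv_eq_zero {φ : Space d → ℂ} (hφ : IsTestFunction D φ)
    (i : Fin d) {x : Space d} (hx : x ∉ D) : partialDeriv i φ x = 0 := by
  have h : fderiv ℝ φ x = 0 := image_eq_zero_of_notMem_tsupport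
    fun h => hx (hφ.support_subset (tsupport_fderiv_subset ℝ h))
  simp [partialDeriv, h]

theorem IsTestFunction.integral_by_parts {ψ φ : Space d → ℂ} (hψ : IsTestFunction D ψ)
    (hφ : IsTestFunction D φ) (i : Fin d) :
    ∫ x in D, ψ x * partialDeriv i φ x = -∫ x in D, partialDeriv i ψ x * φ x := by
  rw [setIntegral_eq_integral_of_forall_compl_eq_zero
      (fun x hx => by rw [hψ.eq_zero hx, zero_mul]),
    setIntegral_eq_integral_of_forall_compl_eq_zero
      (fun x hx => by rw [hφ.eq_zero hx, mul_zero])]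
  have hc := hψ.smooth.continuous
  have hc' := hφ.smooth.continuous
  exact integral_mul_fderiv_eq_neg_fderiv_mul_of_integrable
    (((hψ.continuous_partialDeriv i).mul hc').integrable_of_hasCompactSupport
      (hφ.compact.mul_left))
    ((hc.mul (hφ.continuous_partialDeriv i)).integrable_of_hasCompactSupport
      (hψ.compact.mul_right))
    ((hc.mul hc').integrable_of_hasCompactSupport (hψ.compact.mul_right))
    (fun x _ => hψ.smooth.differentiable (by simp) x)
    (fun x _ => hφ.smooth.differentiable (by simp) x)

/-- The second component of an element of `H₀¹(D)` is the weak gradient of the first one. -/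
theorem H01.hasWeakGradient (u : H01 D) : HasWeakGradient D u.toL2 u.grad := by
  intro φ hφ i
  have hm1 : MemLp (fun x => conj (partialDeriv i φ x)) 2 (volume.restrict D) :=
    ((Complex.continuous_conj.comp (hφ.continuous_partialDeriv i)).memLp_of_hasCompactSupport
      ((hφ.compact_partialDeriv i).comp_left (map_zero _))).restrict D
  have hm2 : MemLp (fun x => EuclideanSpace.single i (conj (φ x))) 2 (volume.restrict D) := by
    refine MemLp.restrict D (Continuous.memLp_of_hasCompactSupport
      (X := Space d) (E := EuclideanSpace ℂ (Fin d)) ?_ ?_)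
    · refine (PiLp.continuous_toLp 2 _).comp ((continuous_single i).comp ?_)
      exact Complex.continuous_conj.comp hφ.smooth.continuous
    · exact hφ.compact.comp_left (g := fun z => EuclideanSpace.single i (conj z)) (by simp)
  set P : L2Pair D := WithLp.toLp 2 (hm1.toLp _, hm2.toLp _) with hP
  have key : ∀ p : L2Pair D, inner ℂ P p
      = (∫ x in D, p.fst x * partialDeriv i φ x) + ∫ x in D, p.snd x i * φ x := by
    intro p
    rw [WithLp.prod_inner_apply, L2.inner_def, L2.inner_def]
    congr 1
    · refine integral_congr_ae ?_
      filter_upwards [hm1.coeFn_toLp] with x hx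
      simp [hP, hx]
    · refine integral_congr_ae ?_
      filter_upwards [hm2.coeFn_toLp] with x hx
      simp [hP, hx, EuclideanSpace.inner_single_left, mul_comm]
  have hle : h01Submodule D ≤ (Submodule.span ℂ {P})ᗮ := by
    refine Submodule.topologicalClosure_minimal _ ?_ (Submodule.isClosed_orthogonal _)
    rw [Submodule.span_le]
    rintro p ⟨ψ, hψ, h1, h2⟩
    rw [SetLike.mem_coe, Submodule.mem_orthogonal_singleton_iff_inner_right, key]
    have e1 : ∫ x in D, p.fst x * partialDeriv i φ x = ∫ x in D, ψ x * partialDeriv i φ x := by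
      refine integral_congr_ae ?_
      filter_upwards [h1] with x hx
      rw [hx]
    have e2 : ∫ x in D, p.snd x i * φ x = ∫ x in D, partialDeriv i ψ x * φ x := by
      refine integral_congr_ae ?_
      filter_upwards [h2] with x hx
      rw [hx]
      rfl
    rw [e1, e2, hψ.integral_by_parts hφ i, neg_add_cancel]
  have := Submodule.mem_orthogonal_singleton_iff_inner_right.1 (hle u.2)
  rw [key] at this
  exact eq_neg_of_add_eq_zero_left this

/-- An element of `H₀¹(D)` is determined by its underlying function. -/
theorem H01.ext_toL2 (hD : IsOpen D) {u v : H01 D} (h : u.toL2 = v.toL2) : u = v := by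
  have hg : u.grad = v.grad := by
    have hloc : ∀ i, LocallyIntegrableOn (fun x => u.grad x i - v.grad x i) D := by
      intro i
      have hm : ∀ w : H01 D, LocallyIntegrable (fun x => w.grad x i) (volume.restrict D) :=
        fun w => ((Lp.memLp w.grad).continuousLinearMap_comp
          (EuclideanSpace.proj (𝕜 := ℂ) i)).locallyIntegrable (by norm_num)
      exact locallyIntegrableOn_of_locallyIntegrable_restrict ((hm u).sub (hm v))
    have hae : ∀ i, ∀ᵐ x ∂(volume.restrict D), u.grad x i - v.grad x i = 0 := by
      intro i
      rw [ae_restrict_iff' hD.measurableSet]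
      refine hD.ae_eq_zero_of_integral_contDiff_smul_eq_zero (hloc i) fun φ h1 h2 h3 => ?_
      have hφ : IsTestFunction D (fun x => (φ x : ℂ)) :=
        ⟨Complex.ofRealCLM.contDiff.comp h1, h2.comp_left Complex.ofReal_zero,
          (closure_mono (Function.support_comp_subset Complex.ofReal_zero φ)).trans h3⟩
      have hu := u.hasWeakGradient _ hφ i
      have hv := v.hasWeakGradient _ hφ i
      rw [h, hv, neg_inj] at hu
      have hint : ∀ w : H01 D, IntegrableOn (fun x => w.grad x i * (φ x : ℂ)) D := by
        intro w
        have a : MemLp (fun x => w.grad x i) 2 (volume.restrict D) :=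
          (Lp.memLp w.grad).continuousLinearMap_comp (EuclideanSpace.proj (𝕜 := ℂ) i)
        have b : MemLp (fun x => (φ x : ℂ)) 2 (volume.restrict D) :=
          (hφ.smooth.continuous.memLp_of_hasCompactSupport hφ.compact).restrict D
        exact MemLp.integrable_mul a b
      rw [← setIntegral_eq_integral_of_forall_compl_eq_zero (s := D)
        (fun x hx => by
          have : φ x = 0 := by exact_mod_cast hφ.eq_zero hx
          rw [this, zero_smul])]
      have : ∀ x, φ x • (u.grad x i - v.grad x i)
          = u.grad x i * (φ x : ℂ) - v.grad x i * (φ x : ℂ) := by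
        intro x
        rw [Complex.real_smul]
        ring
      simp_rw [this]
      rw [integral_sub (hint u) (hint v), hu, sub_self]
    refine Lp.ext ?_
    filter_upwards [ae_all_iff.2 hae] with x hx
    ext i
    exact sub_eq_zero.1 (hx i)
  exact Subtype.ext ((WithLp.ofLp_injective 2) (Prod.ext h hg))

end Helpers

/-- The angular momentum `L_z u = -i (x ∂_y u - y ∂_x u)`; the coordinates `x`, `y` of a point of
`ℝᵈ` (`d = 2, 3`) have the indices `0`, `1`. -/
def angularMomentum {d : ℕ} [NeZero d] {D : Set (Space d)} (u : H01 D) (r : Space d) : ℂ :=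
  -Complex.I * ((r 0 : ℂ) * u.grad r 1 - (r 1 : ℂ) * u.grad r 0)

/-- The Gross-Pitaevskii energy
`E(u) = ∫_D (½|∇u|² + ½ V|u|² + (β/4)|u|⁴ - (Ω/2) ū L_z u)`.
The integral of `ū L_z u` over `D` is real for `u ∈ H₀¹(D)`, since `L_z` is symmetric there; so it
is the integral of the real part. -/
def energy {d : ℕ} [NeZero d] (D : Set (Space d)) (V : Space d → ℝ) (β Ω : ℝ) (u : H01 D) : ℝ :=
  ∫ r in D, ((1 / 2) * ‖u.grad r‖ ^ 2 + (1 / 2) * (V r * ‖u.toL2 r‖ ^ 2)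
    + (β / 4) * ‖u.toL2 r‖ ^ 4
    - (Ω / 2) * (conj (u.toL2 r) * angularMomentum u r).re)

/-- The constraint manifold `{u ∈ H₀¹(D) : ‖u‖_{L²} = 1}`. -/
def sphere {d : ℕ} (D : Set (Space d)) : Set (H01 D) := {u | u.normL2 = 1}

/-- The Sobolev gradient `∇_{H₀¹} E(u)`: the element of `H₀¹(D)` with
`Re (∇_{H₀¹} E(u), h)_{H₀¹} = ⟨E'(u), h⟩` for all `h`, where `E'(u)` is the real Fréchet derivative
of `E` at `u`. -/
def sobolevGrad {d : ℕ} [NeZero d] (D : Set (Space d)) (V : Space d → ℝ) (β Ω : ℝ)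
    (u : H01 D) : H01 D :=
  Classical.epsilon fun g : H01 D =>
    ∀ h : H01 D, (g.innerH h).re = fderiv ℝ (energy D V β Ω) u h

/-- The operator `𝒢_{H₀¹} = (-Δ)⁻¹`: the element of `H₀¹(D)` with
`(𝒢 w, h)_{H₀¹} = (w, h)_{L²}` for all `h`. -/
def greenOp {d : ℕ} {D : Set (Space d)} (w : L2 D) : H01 D :=
  Classical.epsilon fun g : H01 D => ∀ h : H01 D, g.innerH h = inner ℂ w h.toL2

/-- The `H₀¹`-orthogonal projection onto the tangent space of the sphere at `u`,
`𝒫_u w = w - (Re (w, 𝒢 u)_{H₀¹} / ‖𝒢 u‖²_{H₀¹}) 𝒢 u`. -/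
def tangentProj {d : ℕ} {D : Set (Space d)} (u w : H01 D) : H01 D :=
  w - ((w.innerH (greenOp u.toL2)).re / (greenOp u.toL2).normH ^ 2) • greenOp u.toL2

/-- The projected (Riemannian) Sobolev gradient `∇^ℛ_{H₀¹} E(u) = 𝒫_u (∇_{H₀¹} E(u))`. -/
def riemannianGrad {d : ℕ} [NeZero d] (D : Set (Space d)) (V : Space d → ℝ) (β Ω : ℝ)
    (u : H01 D) : H01 D :=
  tangentProj u (sobolevGrad D V β Ω u)

/-- The retraction `R(v) = v / ‖v‖_{L²}`. -/
def retraction {d : ℕ} {D : Set (Space d)} (v : H01 D) : H01 D := v.normL2⁻¹ • v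

/-- `u` is the sequence generated from `u 0 ∈ 𝓜` by the `H₀¹` scheme with step sizes `α`:
`u (n + 1) = R(u n - α n ∇^ℛ_{H₀¹} E(u n))`. -/
def IsH01Scheme {d : ℕ} [NeZero d] (D : Set (Space d)) (V : Space d → ℝ) (β Ω : ℝ)
    (α : ℕ → ℝ) (u : ℕ → H01 D) : Prop :=
  u 0 ∈ sphere D ∧
    ∀ n, u (n + 1) = retraction (u n - α n • riemannianGrad D V β Ω (u n))

end GrossPitaevskii

end

/-!
Write the energy as `E(u) = ½ B(u, u) + (β/4) ‖u²‖²_{L²}` with a bounded real bilinear form `B` on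
`H₀¹(D)`. The product `(u, v) ↦ u v ∈ L²(D)` is bounded because `H₀¹(D)` embeds into `L⁴(D)` in
dimension 2 and 3. This embedding is the only analytic input (`exists_eLpNorm_le_normH`); Poincaré's
inequality follows from it (`exists_norm_le_normH`). It makes `E` differentiable, with a remainder
`E(u + h) - E(u) - E'(u) h` of at most `T ‖h‖²` for `u`, `h` in a given ball
(`quarticFunctional_add_le`). The potential dominates the rotation, so that
`B(u, u) ≥ K / (1 + K) ‖u‖²_{H₀¹}` (`normH_sq_le_integral_quadraticDensity`); hence a sublevel set of
`E` is bounded in `H₀¹(D)`, and `E'` is bounded on it.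

Let `g` be the projected gradient at `u` with `‖u‖_{L²} = 1`. It is `H₀¹`-orthogonal to `𝒢 u`, which
means that it is `L²`-orthogonal to `u`. Therefore `‖u - a g‖_{L²} ≥ 1`, the retraction multiplies
`u - a g` by a number in `[0, 1]`, and since `B ≥ 0` and `β ≥ 0` this does not increase the energy
(`energy_retraction_le`). On the other hand `⟨E'(u), g⟩ = ‖g‖²_{H₀¹}`, as the projection is
orthogonal, so that `E(u - a g) ≤ E(u) - a (1 - C a) ‖g‖²_{H₀¹}`, which is at most
`E(u) - (a/2) ‖g‖²_{H₀¹}` for small `a` (`energy_step`). By induction the iterates stay in the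
sublevel set of `u₀`, on which all the constants depend.
-/

noncomputable section

namespace GrossPitaevskii

/-! ### Quadratic plus quartic functionals on a normed space -/

section QuarticFunctional

variable {H X : Type*} [NormedAddCommGroup H] [NormedSpace ℝ H]
  [NormedAddCommGroup X] [InnerProductSpace ℝ X]

/-- The functional `u ↦ ½ B(u, u) + (β/4) ‖m(u, u)‖²` of a scalar-valued bilinear form `B` and a
vector-valued bilinear map `m`. -/
def quarticFunctional (B : H →L[ℝ] H →L[ℝ] ℝ) (m : H →L[ℝ] H →L[ℝ] X) (β : ℝ) (u : H) : ℝ :=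
  1 / 2 * B u u + β / 4 * ‖m u u‖ ^ 2

/-- The derivative of `quarticFunctional B m β` at `u`. Neither `B` nor `m` has to be symmetric. -/
def quarticFunctionalDeriv (B : H →L[ℝ] H →L[ℝ] ℝ) (m : H →L[ℝ] H →L[ℝ] X) (β : ℝ) (u : H) :
    H →L[ℝ] ℝ :=
  (1 / 2 : ℝ) • (B u + B.flip u) + (β / 2) • (innerSL ℝ (m u u)) ∘L (m u + m.flip u)

variable (B : H →L[ℝ] H →L[ℝ] ℝ) (m : H →L[ℝ] H →L[ℝ] X) {β : ℝ}

theorem quarticFunctionalDeriv_apply (u h : H) :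
    quarticFunctionalDeriv B m β u h =
      1 / 2 * (B u h + B h u) + β / 2 * inner ℝ (m u u) (m u h + m h u) := by
  simp [quarticFunctionalDeriv, inner_add_right]
  ring

theorem hasFDerivAt_quarticFunctional (u : H) :
    HasFDerivAt (quarticFunctional B m β) (quarticFunctionalDeriv B m β u) u := by
  have hB := B.hasFDerivAt_of_bilinear (hasFDerivAt_id (𝕜 := ℝ) u) (hasFDerivAt_id u)
  have hm := (m.hasFDerivAt_of_bilinear (hasFDerivAt_id (𝕜 := ℝ) u) (hasFDerivAt_id u)).norm_sq
  refine ((hB.const_mul (1 / 2)).add (hm.const_mul (β / 4))).congr_fderiv ?_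
  ext h
  simp [quarticFunctionalDeriv_apply, inner_add_right]
  ring

theorem quarticFunctional_add (u h : H) :
    quarticFunctional B m β (u + h) = quarticFunctional B m β u + quarticFunctionalDeriv B m β u h
      + (1 / 2 * B h h + β / 4 *
        (‖(m u h + m h u) + m h h‖ ^ 2 + 2 * inner ℝ (m u u) (m h h))) := by
  have e : m (u + h) (u + h) = m u u + ((m u h + m h u) + m h h) := by
    simp only [map_add, add_apply]; abel
  rw [quarticFunctional, e, norm_add_sq_real, inner_add_right (m u u) (m u h + m h u),
    quarticFunctionalDeriv_apply, quarticFunctional]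
  simp only [map_add, add_apply]
  ring

/-- Boundedness of a bilinear map, in a form that does not mention its operator norm; on `H01 D` the
real operator norm of a bilinear map is not found by instance search. -/
theorem exists_le_mul_norm_mul_norm {Y : Type*} [NormedAddCommGroup Y] [NormedSpace ℝ Y]
    (A : H →L[ℝ] H →L[ℝ] Y) : ∃ a : ℝ, 0 ≤ a ∧ ∀ u v, ‖A u v‖ ≤ a * ‖u‖ * ‖v‖ :=
  ⟨‖A‖, norm_nonneg A, A.le_opNorm₂⟩

variable {B m} {b c : ℝ}

/-- On a ball the first order Taylor polynomial is exact up to a quadratic error. -/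
theorem quarticFunctional_add_le (hb : ∀ u v, ‖B u v‖ ≤ b * ‖u‖ * ‖v‖)
    (hc0 : 0 ≤ c) (hc : ∀ u v, ‖m u v‖ ≤ c * ‖u‖ * ‖v‖)
    (hβ : 0 ≤ β) {R : ℝ} {u h : H} (hu : ‖u‖ ≤ R) (hh : ‖h‖ ≤ R) :
    quarticFunctional B m β (u + h) ≤
      quarticFunctional B m β u + quarticFunctionalDeriv B m β u h
        + (1 / 2 * b + 11 / 4 * β * c ^ 2 * R ^ 2) * ‖h‖ ^ 2 := by
  have hR : 0 ≤ R := (norm_nonneg u).trans hu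
  have hB : B h h ≤ b * ‖h‖ * ‖h‖ := (Real.le_norm_self _).trans (hb h h)
  have h1 : ‖m u h‖ ≤ c * R * ‖h‖ := (hc u h).trans (by gcongr)
  have h2 : ‖m h u‖ ≤ c * R * ‖h‖ := (hc h u).trans (by
    rw [mul_right_comm]; gcongr)
  have h3 : ‖m h h‖ ≤ c * R * ‖h‖ := (hc h h).trans (by gcongr)
  have h4 : ‖m u u‖ ≤ c * R * R := (hc u u).trans (by gcongr)
  have h5 : ‖(m u h + m h u) + m h h‖ ≤ 3 * (c * R * ‖h‖) :=
    (norm_add₃_le).trans (by linarith)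
  have h6 : inner ℝ (m u u) (m h h) ≤ (c * R * R) * (c * ‖h‖ * ‖h‖) :=
    (real_inner_le_norm _ _).trans (by gcongr; exact hc h h)
  have h7 : ‖(m u h + m h u) + m h h‖ ^ 2 ≤ (3 * (c * R * ‖h‖)) ^ 2 := by gcongr
  have h8 : β / 4 * (‖(m u h + m h u) + m h h‖ ^ 2 + 2 * inner ℝ (m u u) (m h h))
      ≤ β / 4 * ((3 * (c * R * ‖h‖)) ^ 2 + 2 * ((c * R * R) * (c * ‖h‖ * ‖h‖))) := by
    gcongr
  rw [quarticFunctional_add]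
  linarith

theorem quarticFunctionalDeriv_apply_le (hb0 : 0 ≤ b) (hb : ∀ u v, ‖B u v‖ ≤ b * ‖u‖ * ‖v‖)
    (hc0 : 0 ≤ c) (hc : ∀ u v, ‖m u v‖ ≤ c * ‖u‖ * ‖v‖)
    (hβ : 0 ≤ β) {R : ℝ} {u : H} (hu : ‖u‖ ≤ R) (h : H) :
    quarticFunctionalDeriv B m β u h ≤ (b * R + β * c ^ 2 * R ^ 3) * ‖h‖ := by
  have hR : 0 ≤ R := (norm_nonneg u).trans hu
  have hB1 : B u h ≤ b * R * ‖h‖ :=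
    (Real.le_norm_self _).trans ((hb u h).trans (by gcongr))
  have hB2 : B h u ≤ b * R * ‖h‖ :=
    (Real.le_norm_self _).trans ((hb h u).trans (by rw [mul_right_comm]; gcongr))
  have h1 : ‖m u h‖ ≤ c * R * ‖h‖ := (hc u h).trans (by gcongr)
  have h2 : ‖m h u‖ ≤ c * R * ‖h‖ := (hc h u).trans (by
    rw [mul_right_comm]; gcongr)
  have h4 : ‖m u u‖ ≤ c * R * R := (hc u u).trans (by gcongr)
  have h6 : inner ℝ (m u u) (m u h + m h u) ≤ (c * R * R) * (2 * (c * R * ‖h‖)) :=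
    (real_inner_le_norm _ _).trans (by
      gcongr; exact (norm_add_le _ _).trans (by linarith))
  have h7 : β / 2 * inner ℝ (m u u) (m u h + m h u)
      ≤ β / 2 * ((c * R * R) * (2 * (c * R * ‖h‖))) := by gcongr
  rw [quarticFunctionalDeriv_apply]
  linarith

theorem quarticFunctional_le (hb0 : 0 ≤ b) (hb : ∀ u v, ‖B u v‖ ≤ b * ‖u‖ * ‖v‖)
    (hc0 : 0 ≤ c) (hc : ∀ u v, ‖m u v‖ ≤ c * ‖u‖ * ‖v‖)
    (hβ : 0 ≤ β) {R : ℝ} {u : H} (hu : ‖u‖ ≤ R) :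
    quarticFunctional B m β u ≤ 1 / 2 * (b * R * R) + β / 4 * (c * R * R) ^ 2 := by
  have hR : 0 ≤ R := (norm_nonneg u).trans hu
  have hB1 : B u u ≤ b * R * R :=
    (Real.le_norm_self _).trans ((hb u u).trans (by gcongr))
  have h4 : ‖m u u‖ ≤ c * R * R := (hc u u).trans (by gcongr)
  rw [quarticFunctional]
  gcongr

/-- Shrinking an argument does not increase a nonnegative quartic functional. -/
theorem quarticFunctional_smul_le (hβ : 0 ≤ β) {v : H} (hv : 0 ≤ B v v) {t : ℝ} (h0 : 0 ≤ t)
    (h1 : t ≤ 1) : quarticFunctional B m β (t • v) ≤ quarticFunctional B m β v := by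
  have hc : t * t ≤ 1 := mul_le_one₀ h1 h0 h1
  simp only [quarticFunctional, map_smul, smul_apply, smul_smul, smul_eq_mul,
    norm_smul, Real.norm_eq_abs]
  rw [abs_of_nonneg (mul_nonneg h0 h0), ← mul_assoc t t]
  gcongr
  · exact mul_le_of_le_one_left hv hc
  · exact mul_le_of_le_one_left (norm_nonneg _) hc

end QuarticFunctional

/-! ### The Sobolev inequality on `H₀¹(D)` -/

section Sobolev

open scoped NNReal ENNReal
open Filter Topology

variable {d : ℕ} {D : Set (Space d)}

theorem norm_fderiv_le_norm_classicalGrad (φ : Space d → ℂ) (x : Space d) :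
    ‖fderiv ℝ φ x‖ ≤ ‖classicalGrad φ x‖ := by
  refine ContinuousLinearMap.opNorm_le_bound _ (norm_nonneg _) fun v => ?_
  have hv : fderiv ℝ φ x v = ∑ i, (v i : ℝ) • partialDeriv i φ x := by
    conv_lhs => rw [← (EuclideanSpace.basisFun (Fin d) ℝ).sum_repr v]
    simp [partialDeriv]
  rw [hv, EuclideanSpace.norm_eq, EuclideanSpace.norm_eq, mul_comm]
  refine (norm_sum_le _ _).trans ?_
  simp_rw [norm_smul]
  exact Real.sum_mul_le_sqrt_mul_sqrt _ _ _

theorem IsTestFunction.continuous_classicalGrad {φ : Space d → ℂ} (hφ : IsTestFunction D φ) :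
    Continuous (classicalGrad φ) :=
  (PiLp.continuous_toLp 2 _).comp (continuous_pi fun i => hφ.continuous_partialDeriv i)

theorem IsTestFunction.add {φ ψ : Space d → ℂ} (hφ : IsTestFunction D φ)
    (hψ : IsTestFunction D ψ) : IsTestFunction D (φ + ψ) where
  smooth := hφ.smooth.add hψ.smooth
  compact := hφ.compact.add hψ.compact
  support_subset := (tsupport_add φ ψ).trans (Set.union_subset hφ.support_subset hψ.support_subset)

theorem IsTestFunction.const_smul {φ : Space d → ℂ} (hφ : IsTestFunction D φ) (c : ℂ) :
    IsTestFunction D (c • φ) where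
  smooth := hφ.smooth.const_smul c
  compact := hφ.compact.smul_left (f := fun _ => c)
  support_subset := (tsupport_smul_subset_right (fun _ => c) φ).trans hφ.support_subset

theorem IsTestFunction.differentiableAt {φ : Space d → ℂ} (hφ : IsTestFunction D φ)
    (x : Space d) : DifferentiableAt ℝ φ x :=
  hφ.smooth.differentiable (by simp) x

/-- The pairs `(φ, ∇φ)` form a linear subspace, so that they are their own span. -/
theorem span_testPairs : (Submodule.span ℂ (testPairs D) : Set (L2Pair D)) = testPairs D := by
  refine le_antisymm (fun p hp => ?_) Submodule.subset_span
  refine Submodule.span_induction (p := fun p _ => p ∈ testPairs D) (fun _ h => h) ?_ ?_ ?_ hp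
  · refine ⟨0, ⟨contDiff_const, HasCompactSupport.zero, by simp [tsupport]⟩, ?_, ?_⟩
    · exact Lp.coeFn_zero _ _ _
    · refine (Lp.coeFn_zero _ _ _).trans (Eventually.of_forall fun x => ?_)
      ext i
      simp [classicalGrad, partialDeriv]
  · rintro p q - - ⟨φ, hφ, hφ1, hφ2⟩ ⟨ψ, hψ, hψ1, hψ2⟩
    refine ⟨φ + ψ, hφ.add hψ, (Lp.coeFn_add _ _).trans (hφ1.add hψ1),
      (Lp.coeFn_add _ _).trans ((hφ2.add hψ2).trans (Eventually.of_forall fun x => ?_))⟩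
    ext i
    simp [classicalGrad, partialDeriv, fderiv_add (hφ.differentiableAt x) (hψ.differentiableAt x)]
  · rintro c p - ⟨φ, hφ, hφ1, hφ2⟩
    refine ⟨c • φ, hφ.const_smul c, (Lp.coeFn_smul _ _).trans (hφ1.const_smul c),
      (Lp.coeFn_smul _ _).trans ((hφ2.const_smul c).trans (Eventually.of_forall fun x => ?_))⟩
    ext i
    simp [classicalGrad, partialDeriv, fderiv_const_smul (hφ.differentiableAt x)]

/-- The Sobolev inequality `‖φ‖_{L⁴} ≤ C ‖∇φ‖_{L²}` on a bounded set in dimension 2 or 3. -/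
theorem exists_eLpNorm_le_eLpNorm_classicalGrad (hd : d = 2 ∨ d = 3)
    (hD : Bornology.IsBounded D) :
    ∃ C : ℝ≥0, ∀ φ : Space d → ℂ, IsTestFunction D φ →
      eLpNorm φ 4 (volume.restrict D) ≤ C * eLpNorm (classicalGrad φ) 2 (volume.restrict D) := by
  -- `p = 12/7` is at most `2` and below the dimension; its Sobolev conjugate is `12` in dimension 2
  -- and `4` in dimension 3.
  set K : ℝ≥0∞ := (eLpNormLESNormFDerivOfLeConst ℂ (volume : Measure (Space d)) D (12 / 7) 4 : ℝ≥0)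
    * (volume D) ^ (1 / ((12 / 7 : ℝ≥0) : ℝ≥0∞).toReal - 1 / (2 : ℝ≥0∞).toReal) with hK
  have hKtop : K ≠ ⊤ := by
    refine ENNReal.mul_ne_top ENNReal.coe_ne_top
      (ENNReal.rpow_ne_top_of_nonneg ?_ hD.measure_lt_top.ne)
    norm_num
  refine ⟨K.toNNReal, fun φ hφ => ?_⟩
  rw [ENNReal.coe_toNNReal hKtop]
  have hsupp : Function.support φ ⊆ D := (subset_tsupport φ).trans hφ.support_subset
  have h1 := eLpNorm_le_eLpNorm_fderiv_of_le (F := ℂ) (volume : Measure (Space d))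
    (hφ.smooth.of_le (by simp)) hsupp (p := 12 / 7) (q := 4)
    (by rw [← NNReal.coe_le_coe]; norm_num)
    (by rw [← NNReal.coe_lt_coe]; rcases hd with rfl | rfl <;> simp <;> norm_num)
    (by rcases hd with rfl | rfl <;> simp <;> norm_num) hD
  have hsupp' : Function.support (fderiv ℝ φ) ⊆ D :=
    (support_fderiv_subset ℝ).trans hφ.support_subset
  calc eLpNorm φ 4 (volume.restrict D)
      ≤ eLpNorm φ (4 : ℝ≥0) volume := by
        simpa using eLpNorm_mono_measure φ (p := 4) (Measure.restrict_le_self (s := D))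
    _ ≤ _ := h1
    _ ≤ (eLpNormLESNormFDerivOfLeConst ℂ (volume : Measure (Space d)) D (12 / 7) 4 : ℝ≥0) *
        eLpNorm (classicalGrad φ) (12 / 7 : ℝ≥0) (volume.restrict D) := by
        rw [← eLpNorm_restrict_eq_of_support_subset (f := fderiv ℝ φ) hsupp']
        gcongr
        exact eLpNorm_mono (norm_fderiv_le_norm_classicalGrad φ)
    _ ≤ _ := by
        have h2 := eLpNorm_le_eLpNorm_mul_rpow_measure_univ (μ := volume.restrict D)
          (p := (12 / 7 : ℝ≥0)) (q := 2) (by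
            rw [show (2 : ℝ≥0∞) = ((2 : ℝ≥0) : ℝ≥0∞) by simp, ENNReal.coe_le_coe,
              ← NNReal.coe_le_coe]
            norm_num)
          hφ.continuous_classicalGrad.aestronglyMeasurable
        rw [Measure.restrict_apply_univ] at h2
        rw [hK, mul_assoc, mul_comm (volume D ^ _)]
        gcongr

/-- The Sobolev inequality extends from test functions to `H₀¹(D)`: the `L⁴` norm is lower
semicontinuous along sequences which converge in `L²`. -/
theorem exists_eLpNorm_le_normH (hd : d = 2 ∨ d = 3) (hD : Bornology.IsBounded D) :
    ∃ C : ℝ≥0, ∀ u : H01 D, eLpNorm u.toL2 4 (volume.restrict D) ≤ C * ENNReal.ofReal u.normH := by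
  obtain ⟨C, hC⟩ := exists_eLpNorm_le_eLpNorm_classicalGrad hd hD
  refine ⟨C, fun u => ?_⟩
  have hu : (u : L2Pair D) ∈ closure (testPairs D) := by
    have h : (u : L2Pair D) ∈ ((Submodule.span ℂ (testPairs D)).topologicalClosure : Set _) := u.2
    rwa [Submodule.topologicalClosure_coe, span_testPairs] at h
  obtain ⟨p, hp, hpu⟩ := mem_closure_iff_seq_limit.1 hu
  have hfst : Tendsto (fun n => (p n).fst) atTop (𝓝 u.toL2) :=
    ((WithLp.prod_continuous_ofLp 2 _ _).fst.tendsto _).comp hpu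
  have hsnd : Tendsto (fun n => (p n).snd) atTop (𝓝 u.grad) :=
    ((WithLp.prod_continuous_ofLp 2 _ _).snd.tendsto _).comp hpu
  have hbound : ∀ n, eLpNorm (p n).fst 4 (volume.restrict D) ≤ C * ENNReal.ofReal ‖(p n).snd‖ := by
    intro n
    obtain ⟨φ, hφ, h1, h2⟩ := hp n
    rw [eLpNorm_congr_ae h1, ofReal_norm, Lp.enorm_def, eLpNorm_congr_ae h2]
    exact hC φ hφ
  refine ENNReal.le_of_forall_pos_le_add fun ε hε _ => ?_
  have hlim : Tendsto (fun n => (C : ℝ≥0∞) * ENNReal.ofReal ‖(p n).snd‖) atTop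
      (𝓝 (C * ENNReal.ofReal u.normH)) :=
    ENNReal.Tendsto.const_mul ((ENNReal.continuous_ofReal.tendsto _).comp hsnd.norm)
      (Or.inr ENNReal.coe_ne_top)
  have hev : ∀ᶠ n in atTop,
      eLpNorm (p n).fst 4 (volume.restrict D) ≤ C * ENNReal.ofReal u.normH + ε := by
    have hlt : (C : ℝ≥0∞) * ENNReal.ofReal u.normH < C * ENNReal.ofReal u.normH + ε :=
      ENNReal.lt_add_right (by finiteness) (by simpa using hε.ne')
    filter_upwards [hlim.eventually_lt_const hlt] with n hn
    exact (hbound n).trans hn.le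
  exact eLpNorm_le_of_tendstoInMeasure hev (tendstoInMeasure_of_tendsto_Lp hfst)
    fun n => Lp.aestronglyMeasurable _

end Sobolev

/-! ### The energy as a quadratic plus quartic functional -/

section Forms

open scoped NNReal ENNReal
open Filter Topology

variable {d : ℕ} {D : Set (Space d)}

namespace H01

variable (D) in
/-- `H01.toL2` as a continuous linear map. -/
def toL2CLM : H01 D →L[ℂ] L2 D := (WithLp.fstL 2 ℂ _ _) ∘L (h01Submodule D).subtypeL

variable (D) in
/-- `H01.grad` as a continuous linear map. -/
def gradCLM : H01 D →L[ℂ] L2Field D := (WithLp.sndL 2 ℂ _ _) ∘L (h01Submodule D).subtypeL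

theorem norm_sq_eq (u : H01 D) : ‖u‖ ^ 2 = u.normL2 ^ 2 + u.normH ^ 2 :=
  WithLp.prod_norm_sq_eq_of_L2 _

theorem normH_le_norm (u : H01 D) : u.normH ≤ ‖u‖ := by
  have := u.norm_sq_eq
  exact le_of_sq_le_sq (by nlinarith [sq_nonneg u.normL2]) (norm_nonneg _)

end H01

instance fact_one_le_four_ennreal : Fact ((1 : ℝ≥0∞) ≤ 4) := ⟨by norm_num⟩

/-- The embedding `H₀¹(D) → L⁴(D)`. -/
theorem exists_toL4 (hd : d = 2 ∨ d = 3) (hD : Bornology.IsBounded D) :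
    ∃ J : H01 D →L[ℂ] Lp ℂ 4 (volume.restrict D), ∀ u : H01 D, J u =ᵐ[volume.restrict D] u.toL2 := by
  obtain ⟨C, hC⟩ := exists_eLpNorm_le_normH hd hD
  have hmem : ∀ u : H01 D, MemLp u.toL2 4 (volume.restrict D) := fun u =>
    ⟨Lp.aestronglyMeasurable _, (hC u).trans_lt (by finiteness)⟩
  let J : H01 D →ₗ[ℂ] Lp ℂ 4 (volume.restrict D) :=
    { toFun := fun u => (hmem u).toLp _
      map_add' := fun u v => by
        rw [← MemLp.toLp_add]
        exact MemLp.toLp_congr _ _ (Lp.coeFn_add u.toL2 v.toL2)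
      map_smul' := fun c u => by
        rw [RingHom.id_apply, ← MemLp.toLp_const_smul]
        exact MemLp.toLp_congr _ _ (Lp.coeFn_smul c u.toL2) }
  refine ⟨J.mkContinuous C fun u => ?_, fun u => (hmem u).coeFn_toLp⟩
  change ‖(hmem u).toLp _‖ ≤ _
  rw [Lp.norm_toLp]
  refine ENNReal.toReal_le_of_le_ofReal (by positivity) ((hC u).trans ?_)
  rw [ENNReal.ofReal_mul C.coe_nonneg, ENNReal.ofReal_coe_nnreal]
  gcongr
  exact u.normH_le_norm

/-- The product `u v ∈ L²(D)` of `u, v ∈ H₀¹(D)` is a bounded bilinear map, and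
`‖u²‖²_{L²} = ‖u‖⁴_{L⁴}`. -/
theorem exists_productMap (hd : d = 2 ∨ d = 3) (hD : Bornology.IsBounded D) :
    ∃ m : H01 D →L[ℝ] H01 D →L[ℝ] L2 D, ∀ u : H01 D,
      Integrable (fun r => ‖u.toL2 r‖ ^ 4) (volume.restrict D) ∧
      ‖m u u‖ ^ 2 = ∫ r in D, ‖u.toL2 r‖ ^ 4 := by
  obtain ⟨J, hJ⟩ := exists_toL4 hd hD
  have : ENNReal.HolderTriple 4 4 2 := ⟨by
    rw [← ENNReal.toReal_eq_toReal_iff' (by simp) (by simp), ENNReal.toReal_add (by simp) (by simp)]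
    norm_num⟩
  let J' : H01 D →L[ℝ] Lp ℂ 4 (volume.restrict D) := J.restrictScalars ℝ
  refine ⟨((ContinuousLinearMap.mul ℝ ℂ).holderL (volume.restrict D) 4 4 2).bilinearComp J' J',
    fun u => ?_⟩
  have hm := (ContinuousLinearMap.mul ℝ ℂ).coeFn_holder (r := 2) (J' u) (J' u)
  have hm' : (fun r => ‖((ContinuousLinearMap.mul ℝ ℂ).holder 2 (J' u) (J' u)) r‖ ^ 2)
      =ᵐ[volume.restrict D] fun r => ‖u.toL2 r‖ ^ 4 := by
    filter_upwards [hm, hJ u] with r h1 h2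
    rw [h1, show J' u = J u from rfl, h2]
    simp
    ring
  refine ⟨((Lp.memLp _).integrable_norm_pow two_ne_zero).congr hm', ?_⟩
  rw [← integral_congr_ae hm']
  simp only [ContinuousLinearMap.bilinearComp_apply, ContinuousLinearMap.holderL_apply_apply]
  rw [← real_inner_self_eq_norm_sq, L2.inner_def]
  simp_rw [real_inner_self_eq_norm_sq]

/-- Multiplication by a bounded function is a bounded operator on `L²(D)`. -/
theorem exists_multiplication {a : Space d → ℝ} (ha : MemLp a ⊤ (volume.restrict D)) :
    ∃ M : L2 D →L[ℝ] L2 D, ∀ f, M f =ᵐ[volume.restrict D] fun r => (a r : ℂ) * f r := by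
  refine ⟨(ContinuousLinearMap.lsmul ℝ ℝ).holderL (volume.restrict D) ⊤ 2 2 (ha.toLp a),
    fun f => ?_⟩
  rw [ContinuousLinearMap.holderL_apply_apply]
  filter_upwards [(ContinuousLinearMap.lsmul ℝ ℝ).coeFn_holder (r := 2) (ha.toLp a) f,
    ha.coeFn_toLp] with r h1 h2
  rw [h1, h2]
  simp

theorem memLp_top_coord (hD : Bornology.IsBounded D) (hDm : MeasurableSet D) (i : Fin d) :
    MemLp (fun r : Space d => r i) ⊤ (volume.restrict D) := by
  obtain ⟨C, hC⟩ := hD.exists_norm_le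
  refine memLp_top_of_bound (by fun_prop) C ?_
  filter_upwards [ae_restrict_mem hDm] with r hr
  exact (PiLp.norm_apply_le r i).trans (hC r hr)

theorem exists_angularMomentum [NeZero d] (hD : Bornology.IsBounded D) (hDm : MeasurableSet D) :
    ∃ L : H01 D →L[ℝ] L2 D, ∀ u, L u =ᵐ[volume.restrict D] angularMomentum u := by
  obtain ⟨M₀, hM₀⟩ := exists_multiplication (memLp_top_coord hD hDm 0)
  obtain ⟨M₁, hM₁⟩ := exists_multiplication (memLp_top_coord hD hDm 1)
  let P (i : Fin d) : L2Field D →L[ℝ] L2 D :=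
    (((EuclideanSpace.proj i : EuclideanSpace ℂ (Fin d) →L[ℂ] ℂ)).compLpL 2
      (volume.restrict D)).restrictScalars ℝ
  have hP : ∀ i (g : L2Field D), P i g =ᵐ[volume.restrict D] fun r => g r i := fun i g =>
    (EuclideanSpace.proj i : EuclideanSpace ℂ (Fin d) →L[ℂ] ℂ).coeFn_compLpL g
  refine ⟨(-Complex.I) • ((M₀ ∘L P 1 - M₁ ∘L P 0) ∘L (H01.gradCLM D).restrictScalars ℝ),
    fun u => ?_⟩
  change -Complex.I • (M₀ (P 1 u.grad) - M₁ (P 0 u.grad)) =ᵐ[volume.restrict D] _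
  filter_upwards [Lp.coeFn_smul (-Complex.I) (M₀ (P 1 u.grad) - M₁ (P 0 u.grad)),
    Lp.coeFn_sub (M₀ (P 1 u.grad)) (M₁ (P 0 u.grad)), hM₀ (P 1 u.grad), hM₁ (P 0 u.grad),
    hP 1 u.grad, hP 0 u.grad] with r h1 h2 h3 h4 h5 h6
  rw [h1, Pi.smul_apply, h2, Pi.sub_apply, h3, h4, h5, h6]
  rfl

/-- The integrand of the quadratic part of twice the energy. -/
def quadraticDensity [NeZero d] (V : Space d → ℝ) (Ω : ℝ) (u : H01 D) (r : Space d) : ℝ :=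
  ‖u.grad r‖ ^ 2 + V r * ‖u.toL2 r‖ ^ 2 - Ω * (conj (u.toL2 r) * angularMomentum u r).re

theorem exists_quadraticForm [NeZero d] (hD : Bornology.IsBounded D) (hDm : MeasurableSet D)
    {V : Space d → ℝ} (hV : MemLp V ⊤ (volume.restrict D)) (Ω : ℝ) :
    ∃ B : H01 D →L[ℝ] H01 D →L[ℝ] ℝ, ∀ u : H01 D,
      Integrable (quadraticDensity V Ω u) (volume.restrict D) ∧
      B u u = ∫ r in D, quadraticDensity V Ω u r := by
  obtain ⟨L, hL⟩ := exists_angularMomentum hD hDm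
  obtain ⟨M, hM⟩ := exists_multiplication hV
  let G : H01 D →L[ℝ] L2Field D := (H01.gradCLM D).restrictScalars ℝ
  let I : H01 D →L[ℝ] L2 D := (H01.toL2CLM D).restrictScalars ℝ
  refine ⟨(innerSL ℝ).bilinearComp G G + (innerSL ℝ).bilinearComp I (M ∘L I - Ω • L), fun u => ?_⟩
  have h : (fun r => inner ℝ (u.grad r) (u.grad r) + inner ℝ (u.toL2 r) ((M u.toL2 - Ω • L u) r))
      =ᵐ[volume.restrict D] quadraticDensity V Ω u := by
    filter_upwards [Lp.coeFn_sub (M u.toL2) (Ω • L u), Lp.coeFn_smul Ω (L u), hL u, hM u.toL2]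
      with r h1 h2 h3 h4
    rw [h1, Pi.sub_apply, h2, Pi.smul_apply, h3, h4, real_inner_self_eq_norm_sq, quadraticDensity,
      inner_sub_right, inner_smul_right, Complex.inner, Complex.inner, add_sub_assoc,
      mul_assoc, Complex.re_ofReal_mul, Complex.mul_conj', mul_comm (angularMomentum u r)]
    norm_cast
  have i1 := L2.integrable_inner (𝕜 := ℝ) u.grad u.grad
  have i2 := L2.integrable_inner (𝕜 := ℝ) u.toL2 (M u.toL2 - Ω • L u)
  refine ⟨(i1.add i2).congr h, ?_⟩
  rw [← integral_congr_ae h, integral_add i1 i2, ← L2.inner_def, ← L2.inner_def]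
  rfl

theorem energy_eq [NeZero d] {V : Space d → ℝ} {β Ω : ℝ} {B : H01 D →L[ℝ] H01 D →L[ℝ] ℝ}
    {m : H01 D →L[ℝ] H01 D →L[ℝ] L2 D}
    (hB : ∀ u : H01 D, Integrable (quadraticDensity V Ω u) (volume.restrict D) ∧
      B u u = ∫ r in D, quadraticDensity V Ω u r)
    (hm : ∀ u : H01 D, Integrable (fun r => ‖u.toL2 r‖ ^ 4) (volume.restrict D) ∧
      ‖m u u‖ ^ 2 = ∫ r in D, ‖u.toL2 r‖ ^ 4) :
    energy D V β Ω = quarticFunctional B m β := by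
  ext u
  rw [quarticFunctional, (hB u).2, (hm u).2, ← integral_const_mul, ← integral_const_mul,
    ← integral_add ((hB u).1.const_mul _) ((hm u).1.const_mul _), energy]
  congr 1
  ext r
  rw [quadraticDensity]
  ring

/-- The Cauchy-Schwarz inequality for the rotation term. -/
theorem re_mul_angularMomentum_le [NeZero d] (hd : 2 ≤ d) (u : H01 D) (r : Space d) :
    (conj (u.toL2 r) * angularMomentum u r).re
      ≤ ‖u.toL2 r‖ * (√(r 0 ^ 2 + r 1 ^ 2) * ‖u.grad r‖) := by
  have h01 : (0 : Fin d) ≠ 1 := by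
    rw [Ne, Fin.ext_iff, Fin.val_zero, Fin.val_one', Nat.mod_eq_of_lt (by lia)]
    simp
  have hsum : ‖u.grad r 1‖ ^ 2 + ‖u.grad r 0‖ ^ 2 ≤ ‖u.grad r‖ ^ 2 := by
    rw [EuclideanSpace.norm_sq_eq, add_comm, ← Finset.sum_pair (f := fun i => ‖u.grad r i‖ ^ 2) h01]
    exact Finset.sum_le_sum_of_subset_of_nonneg (Finset.subset_univ _) fun _ _ _ => by positivity
  have hL : ‖angularMomentum u r‖ ≤ √(r 0 ^ 2 + r 1 ^ 2) * ‖u.grad r‖ := by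
    have h1 : ‖angularMomentum u r‖ ≤ |r 0| * ‖u.grad r 1‖ + |r 1| * ‖u.grad r 0‖ := by
      rw [angularMomentum, norm_mul, norm_neg, Complex.norm_I, one_mul]
      refine (norm_sub_le _ _).trans_eq ?_
      simp
    refine h1.trans (le_of_sq_le_sq ?_ (by positivity))
    rw [mul_pow, Real.sq_sqrt (by positivity)]
    refine le_trans ?_ (mul_le_mul_of_nonneg_left hsum (by positivity))
    nlinarith [sq_nonneg (|r 0| * ‖u.grad r 0‖ - |r 1| * ‖u.grad r 1‖), sq_abs (r 0), sq_abs (r 1)]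
  calc (conj (u.toL2 r) * angularMomentum u r).re
      ≤ ‖conj (u.toL2 r) * angularMomentum u r‖ := Complex.re_le_norm _
    _ = ‖u.toL2 r‖ * ‖angularMomentum u r‖ := by rw [norm_mul, RCLike.norm_conj]
    _ ≤ _ := by gcongr

/-- The trapping potential dominates the rotation, so that the quadratic part of the energy is
coercive. -/
theorem normH_sq_le_integral_quadraticDensity [NeZero d] (hd : 2 ≤ d) {V : Space d → ℝ}
    {Ω K : ℝ} (hΩ : 0 ≤ Ω) (hK : 0 < K)
    (hV : ∀ᵐ r ∂(volume.restrict D), (1 + K) / 4 * Ω ^ 2 * ((r 0) ^ 2 + (r 1) ^ 2) ≤ V r)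
    {u : H01 D} (hu : Integrable (quadraticDensity V Ω u) (volume.restrict D)) :
    K / (1 + K) * u.normH ^ 2 ≤ ∫ r in D, quadraticDensity V Ω u r := by
  have hn : u.normH ^ 2 = ∫ r in D, ‖u.grad r‖ ^ 2 := by
    rw [H01.normH, ← real_inner_self_eq_norm_sq, L2.inner_def]
    simp_rw [real_inner_self_eq_norm_sq]
  rw [hn, ← integral_const_mul]
  refine integral_mono_ae (((Lp.memLp u.grad).integrable_norm_pow two_ne_zero).const_mul _) hu ?_
  filter_upwards [hV] with r hr
  have h1 := mul_le_mul_of_nonneg_left (re_mul_angularMomentum_le hd u r) hΩ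
  have h2 := mul_le_mul_of_nonneg_right hr (sq_nonneg ‖u.toL2 r‖)
  rw [← Real.sq_sqrt (show 0 ≤ r 0 ^ 2 + r 1 ^ 2 by positivity)] at h2
  set q := √(r 0 ^ 2 + r 1 ^ 2)
  -- Young's inequality with the weight that uses up exactly the lower bound of the potential.
  have h3 : Ω * (‖u.toL2 r‖ * (q * ‖u.grad r‖))
      ≤ 1 / (1 + K) * ‖u.grad r‖ ^ 2 + (1 + K) / 4 * Ω ^ 2 * q ^ 2 * ‖u.toL2 r‖ ^ 2 := by
    have : 0 ≤ 1 / (1 + K) * (‖u.grad r‖ - (1 + K) / 2 * (Ω * q * ‖u.toL2 r‖)) ^ 2 := by positivity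
    have e : 1 / (1 + K) * (‖u.grad r‖ - (1 + K) / 2 * (Ω * q * ‖u.toL2 r‖)) ^ 2
        = 1 / (1 + K) * ‖u.grad r‖ ^ 2 + (1 + K) / 4 * Ω ^ 2 * q ^ 2 * ‖u.toL2 r‖ ^ 2
          - Ω * (‖u.toL2 r‖ * (q * ‖u.grad r‖)) := by
      field_simp
      ring
    linarith
  have h4 : K / (1 + K) * ‖u.grad r‖ ^ 2 = ‖u.grad r‖ ^ 2 - 1 / (1 + K) * ‖u.grad r‖ ^ 2 := by
    field_simp
    ring
  rw [quadraticDensity, h4]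
  linarith

/-- Poincaré's inequality: `‖∇u‖_{L²}` controls the full `H¹` norm. -/
theorem exists_norm_le_normH (hd : d = 2 ∨ d = 3) (hD : Bornology.IsBounded D) :
    ∃ κ : ℝ, 0 < κ ∧ ∀ u : H01 D, ‖u‖ ≤ κ * u.normH := by
  obtain ⟨C, hC⟩ := exists_eLpNorm_le_normH hd hD
  set c : ℝ≥0∞ := volume D ^ (1 / (2 : ℝ≥0∞).toReal - 1 / (4 : ℝ≥0∞).toReal) with hc
  have hctop : c ≠ ⊤ := ENNReal.rpow_ne_top_of_nonneg (by norm_num) hD.measure_lt_top.ne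
  have hL2 : ∀ u : H01 D, u.normL2 ≤ C * c.toReal * u.normH := by
    intro u
    have h := eLpNorm_le_eLpNorm_mul_rpow_measure_univ (μ := volume.restrict D) (p := 2) (q := 4)
      (by norm_num) (Lp.aestronglyMeasurable u.toL2)
    rw [Measure.restrict_apply_univ, ← hc] at h
    have h' := ENNReal.toReal_mono (by finiteness) (h.trans (mul_le_mul_left (hC u) c))
    rw [ENNReal.toReal_mul, ENNReal.toReal_mul,
      ENNReal.toReal_ofReal (show 0 ≤ u.normH from norm_nonneg _)] at h'
    rw [H01.normL2, Lp.norm_def]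
    refine h'.trans_eq ?_
    rw [ENNReal.coe_toReal]
    ring
  refine ⟨C * c.toReal + 1, by positivity, fun u => ?_⟩
  have hH : 0 ≤ u.normH := norm_nonneg _
  have h0 : 0 ≤ u.normL2 := norm_nonneg _
  refine le_of_sq_le_sq ?_ (by positivity)
  have h1 : u.normL2 ^ 2 ≤ (C * c.toReal * u.normH) ^ 2 := by gcongr; exact hL2 u
  have h2 : 0 ≤ C * c.toReal * u.normH * u.normH := by positivity
  rw [H01.norm_sq_eq]
  nlinarith

end Forms

/-! ### The Sobolev gradient, the Green operator and the tangential projection -/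

section Gradients

variable {d : ℕ} {D : Set (Space d)} {κ : ℝ}

namespace H01

theorem innerH_self_re (g : H01 D) : (g.innerH g).re = g.normH ^ 2 :=
  inner_self_eq_norm_sq (𝕜 := ℂ) g.grad

theorem innerH_re_comm (g h : H01 D) : (g.innerH h).re = (h.innerH g).re :=
  inner_re_symm (𝕜 := ℂ) g.grad h.grad

theorem innerH_sub_smul_re (g v w : H01 D) (c : ℝ) :
    ((v - c • w).innerH g).re = (v.innerH g).re - c * (w.innerH g).re := by
  have : (v - c • w).grad = v.grad - (c : ℂ) • w.grad := rfl
  rw [innerH, this, inner_sub_left, inner_smul_left, Complex.conj_ofReal, Complex.sub_re,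
    Complex.re_ofReal_mul]
  rfl

theorem normL2_smul (c : ℝ) (g : H01 D) : (c • g).normL2 = |c| * g.normL2 := by
  have : (c • g).toL2 = (c : ℂ) • g.toL2 := rfl
  rw [normL2, this, norm_smul, Complex.norm_real, Real.norm_eq_abs]
  rfl

end H01

/-- The Riesz representation theorem in `H₀¹(D)` with the inner product `(·, ·)_{H₀¹}`, which
induces an equivalent norm by Poincaré's inequality. -/
theorem exists_innerH_eq (hκ : 0 < κ) (hP : ∀ u : H01 D, ‖u‖ ≤ κ * u.normH) (φ : H01 D →L[ℂ] ℂ) :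
    ∃ g : H01 D, ∀ h, g.innerH h = φ h := by
  have : CompleteSpace (H01 D) := Submodule.topologicalClosure.completeSpace _
  let T := (ContinuousLinearMap.adjoint (H01.gradCLM D)) ∘L H01.gradCLM D
  have hT : ∀ g h : H01 D, inner ℂ (T g) h = g.innerH h := fun g h => by
    rw [ContinuousLinearMap.comp_apply, ContinuousLinearMap.adjoint_inner_left]
    rfl
  have hunit : IsUnit T := by
    refine T.isUnit_of_forall_le_norm_inner_map (c := ((κ ^ 2)⁻¹).toNNReal)
      (Real.toNNReal_pos.2 (by positivity)) fun x => ?_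
    rw [hT, Real.coe_toNNReal _ (by positivity)]
    refine le_trans ?_ (Complex.re_le_norm _)
    rw [x.innerH_self_re, ← div_eq_mul_inv, div_le_iff₀ (by positivity), ← mul_pow,
      mul_comm x.normH]
    gcongr
    exact hP x
  obtain ⟨g, hg⟩ := ((ContinuousLinearMap.isUnit_iff_bijective).1 hunit).2
    ((InnerProductSpace.toDual ℂ (H01 D)).symm φ)
  exact ⟨g, fun h => by rw [← hT, hg, InnerProductSpace.toDual_symm_apply]⟩

theorem sobolevGrad_innerH_re [NeZero d] (hκ : 0 < κ) (hP : ∀ u : H01 D, ‖u‖ ≤ κ * u.normH)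
    (V : Space d → ℝ) (β Ω : ℝ) (u h : H01 D) :
    ((sobolevGrad D V β Ω u).innerH h).re = fderiv ℝ (energy D V β Ω) u h := by
  obtain ⟨g, hg⟩ := exists_innerH_eq hκ hP
    (StrongDual.extendRCLike (𝕜 := ℂ) (fderiv ℝ (energy D V β Ω) u))
  refine Classical.epsilon_spec (p := fun g : H01 D =>
    ∀ h : H01 D, (g.innerH h).re = fderiv ℝ (energy D V β Ω) u h) ⟨g, fun h => ?_⟩ h
  rw [hg]
  exact StrongDual.re_extendRCLike_apply (𝕜 := ℂ) _ h

theorem greenOp_innerH (hκ : 0 < κ) (hP : ∀ u : H01 D, ‖u‖ ≤ κ * u.normH) (w : L2 D) (h : H01 D) :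
    (greenOp w).innerH h = inner ℂ w h.toL2 := by
  obtain ⟨g, hg⟩ := exists_innerH_eq hκ hP ((innerSL ℂ w) ∘L H01.toL2CLM D)
  exact Classical.epsilon_spec (p := fun g : H01 D => ∀ h : H01 D, g.innerH h = inner ℂ w h.toL2)
    ⟨g, hg⟩ h

/-- `𝒫_u w` is orthogonal to `𝒢 u`. This holds also if `𝒢 u = 0`, where the quotient in
`tangentProj` is zero. -/
theorem tangentProj_innerH_greenOp_re (u w : H01 D) :
    ((tangentProj u w).innerH (greenOp u.toL2)).re = 0 := by
  rw [tangentProj, H01.innerH_sub_smul_re, H01.innerH_self_re]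
  by_cases h : (greenOp u.toL2).normH = 0
  · have : (greenOp u.toL2).grad = 0 := norm_eq_zero.1 h
    simp [H01.innerH, this]
  · field_simp
    ring

/-- `(w, 𝒫_u w)_{H₀¹} = ‖𝒫_u w‖²_{H₀¹}`: the projection is orthogonal. -/
theorem innerH_tangentProj_re (u w : H01 D) :
    (w.innerH (tangentProj u w)).re = (tangentProj u w).normH ^ 2 := by
  have h := H01.innerH_sub_smul_re (tangentProj u w) w (greenOp u.toL2)
    ((w.innerH (greenOp u.toL2)).re / (greenOp u.toL2).normH ^ 2)
  rw [← tangentProj, H01.innerH_self_re, H01.innerH_re_comm (greenOp u.toL2),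
    tangentProj_innerH_greenOp_re, mul_zero, sub_zero] at h
  exact h.symm

theorem normH_tangentProj_le (u w : H01 D) : (tangentProj u w).normH ≤ w.normH := by
  have h := innerH_tangentProj_re u w
  have h1 : (w.innerH (tangentProj u w)).re ≤ w.normH * (tangentProj u w).normH :=
    (Complex.re_le_norm _).trans (norm_inner_le_norm _ _)
  have h2 : 0 ≤ w.normH := norm_nonneg _
  by_contra! hlt
  nlinarith

/-- A step along a tangent vector does not decrease the `L²` norm. -/
theorem normL2_le_normL2_sub_smul_tangentProj (hκ : 0 < κ)
    (hP : ∀ u : H01 D, ‖u‖ ≤ κ * u.normH) (u w : H01 D) (a : ℝ) :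
    u.normL2 ≤ (u - a • tangentProj u w).normL2 := by
  have h0 : (inner ℂ u.toL2 (tangentProj u w).toL2).re = 0 := by
    rw [← greenOp_innerH hκ hP, H01.innerH_re_comm, tangentProj_innerH_greenOp_re]
  have e : (u - a • tangentProj u w).toL2 = u.toL2 - (a : ℂ) • (tangentProj u w).toL2 := rfl
  refine le_of_sq_le_sq ?_ (norm_nonneg _)
  rw [H01.normL2, H01.normL2, e, norm_sub_sq (𝕜 := ℂ), inner_smul_right]
  have h1 : RCLike.re ((a : ℂ) * inner ℂ u.toL2 (tangentProj u w).toL2) = 0 := by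
    rw [RCLike.re_eq_complex_re, Complex.re_ofReal_mul, h0, mul_zero]
  rw [h1]
  nlinarith [sq_nonneg ‖(a : ℂ) • (tangentProj u w).toL2‖]

theorem retraction_mem_sphere {v : H01 D} (hv : v.normL2 ≠ 0) : retraction v ∈ sphere D := by
  have h : 0 < v.normL2 := lt_of_le_of_ne (norm_nonneg _) hv.symm
  change (retraction v).normL2 = 1
  rw [retraction, H01.normL2_smul, abs_of_pos (inv_pos.2 h), inv_mul_cancel₀ hv]

end Gradients

/-! ### Energy dissipation -/

section Dissipation

variable {d : ℕ} [NeZero d] {D : Set (Space d)} {κ : ℝ} {V : Space d → ℝ} {β Ω : ℝ}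
  {B : H01 D →L[ℝ] H01 D →L[ℝ] ℝ} {m : H01 D →L[ℝ] H01 D →L[ℝ] L2 D} {b c : ℝ}

theorem sobolevGrad_innerH_re_eq (hκ : 0 < κ) (hP : ∀ u : H01 D, ‖u‖ ≤ κ * u.normH)
    (hE : energy D V β Ω = quarticFunctional B m β) (u h : H01 D) :
    ((sobolevGrad D V β Ω u).innerH h).re = quarticFunctionalDeriv B m β u h := by
  rw [sobolevGrad_innerH_re hκ hP, hE, (hasFDerivAt_quarticFunctional B m u).fderiv]

theorem normH_sobolevGrad_le (hb0 : 0 ≤ b) (hb : ∀ u v, ‖B u v‖ ≤ b * ‖u‖ * ‖v‖)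
    (hc0 : 0 ≤ c) (hc : ∀ u v, ‖m u v‖ ≤ c * ‖u‖ * ‖v‖)
    (hκ : 0 < κ) (hP : ∀ u : H01 D, ‖u‖ ≤ κ * u.normH) (hβ : 0 ≤ β)
    (hE : energy D V β Ω = quarticFunctional B m β) {R : ℝ} {u : H01 D} (hu : ‖u‖ ≤ R) :
    (sobolevGrad D V β Ω u).normH ≤ (b * R + β * c ^ 2 * R ^ 3) * κ := by
  have hR : 0 ≤ R := (norm_nonneg u).trans hu
  set g := sobolevGrad D V β Ω u
  have hg : 0 ≤ g.normH := norm_nonneg _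
  have h1 : g.normH ^ 2 ≤ (b * R + β * c ^ 2 * R ^ 3) * κ * g.normH := by
    rw [← g.innerH_self_re, sobolevGrad_innerH_re_eq hκ hP hE, mul_assoc]
    refine (quarticFunctionalDeriv_apply_le hb0 hb hc0 hc hβ hu g).trans ?_
    gcongr
    exact hP g
  have h2 : 0 ≤ (b * R + β * c ^ 2 * R ^ 3) * κ := by positivity
  by_contra! hlt
  nlinarith

/-- The retraction does not increase the energy, because it shrinks its argument. -/
theorem energy_retraction_le (hβ : 0 ≤ β) (hE : energy D V β Ω = quarticFunctional B m β)
    {v : H01 D} (hBv : 0 ≤ B v v) (hv : 1 ≤ v.normL2) :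
    energy D V β Ω (retraction v) ≤ energy D V β Ω v := by
  rw [hE]
  exact quarticFunctional_smul_le hβ hBv (inv_nonneg.2 (zero_le_one.trans hv))
    (inv_le_one_of_one_le₀ hv)

theorem mul_sq_le_of_le_mul {T a s p κ : ℝ} (hT : 0 ≤ T) (hs0 : 0 ≤ s) (hs : s ≤ a * (κ * p))
    (ha : 0 ≤ a) (haT : a * (T * κ ^ 2) ≤ 1 / 2) : T * s ^ 2 ≤ 1 / 2 * (a * p ^ 2) :=
  calc T * s ^ 2 ≤ T * (a * (κ * p)) ^ 2 := by gcongr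
    _ = a * (T * κ ^ 2) * (a * p ^ 2) := by ring
    _ ≤ 1 / 2 * (a * p ^ 2) := by gcongr

/-- One step of the scheme with a step size `a` that is small compared with the constant of the
quadratic Taylor remainder. -/
theorem energy_step (hb0 : 0 ≤ b) (hb : ∀ u v, ‖B u v‖ ≤ b * ‖u‖ * ‖v‖)
    (hc0 : 0 ≤ c) (hc : ∀ u v, ‖m u v‖ ≤ c * ‖u‖ * ‖v‖)
    (hκ : 0 < κ) (hP : ∀ u : H01 D, ‖u‖ ≤ κ * u.normH) (hβ : 0 ≤ β)
    (hE : energy D V β Ω = quarticFunctional B m β) (hB : ∀ v, 0 ≤ B v v) {R a : ℝ} {u : H01 D}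
    (hu : u ∈ sphere D) (huR : ‖u‖ ≤ R) (ha : 0 ≤ a) (ha1 : a ≤ 1)
    (hgR : κ * (sobolevGrad D V β Ω u).normH ≤ R)
    (haT : a * ((1 / 2 * b + 11 / 4 * β * c ^ 2 * R ^ 2) * κ ^ 2) ≤ 1 / 2) :
    energy D V β Ω (retraction (u - a • riemannianGrad D V β Ω u))
      ≤ energy D V β Ω u - a / 2 * (riemannianGrad D V β Ω u).normH ^ 2 := by
  set T := 1 / 2 * b + 11 / 4 * β * c ^ 2 * R ^ 2 with hT
  have hT0 : 0 ≤ T := by positivity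
  set g := riemannianGrad D V β Ω u with hg
  have hg0 : 0 ≤ g.normH := norm_nonneg _
  have hgle : g.normH ≤ (sobolevGrad D V β Ω u).normH := normH_tangentProj_le _ _
  have hu1 : u.normL2 = 1 := hu
  have h1 : 1 ≤ (u - a • g).normL2 :=
    hu1.symm.le.trans (normL2_le_normL2_sub_smul_tangentProj hκ hP u _ a)
  refine (energy_retraction_le hβ hE (hB _) h1).trans ?_
  have hstep : ‖(-a) • g‖ ≤ a * (κ * g.normH) := by
    rw [norm_smul, norm_neg, Real.norm_of_nonneg ha]
    gcongr
    exact hP g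
  have hstepR : ‖(-a) • g‖ ≤ R := by
    refine hstep.trans ((mul_le_of_le_one_left (by positivity) ha1).trans (le_trans ?_ hgR))
    gcongr
  have hderiv : quarticFunctionalDeriv B m β u ((-a) • g) = -a * g.normH ^ 2 := by
    rw [map_smul, ← sobolevGrad_innerH_re_eq hκ hP hE, smul_eq_mul, hg, riemannianGrad,
      innerH_tangentProj_re]
  have htaylor := quarticFunctional_add_le hb hc0 hc hβ huR hstepR
  rw [hderiv, ← hT] at htaylor
  have hquad := mul_sq_le_of_le_mul hT0 (norm_nonneg _) hstep ha haT
  rw [sub_eq_add_neg, ← neg_smul, hE]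
  linarith

/-- On the part of the sphere in a sublevel set of the energy, the norms of the points and of the
gradients are bounded, and one bound on the step size makes every step dissipate energy. -/
theorem exists_dissipation_constants (hκ : 0 < κ) (hP : ∀ u : H01 D, ‖u‖ ≤ κ * u.normH)
    (hβ : 0 ≤ β) (hE : energy D V β Ω = quarticFunctional B m β) {δ : ℝ} (hδ : 0 < δ)
    (hB : ∀ v : H01 D, δ * v.normH ^ 2 ≤ B v v) (E₀ : ℝ) :
    ∃ Cu Cg Cα : ℝ, 0 < Cu ∧ 0 < Cg ∧ 0 < Cα ∧ Cα ≤ 1 ∧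
      ∀ v ∈ sphere D, energy D V β Ω v ≤ E₀ →
        v.normH ≤ Cu ∧ (sobolevGrad D V β Ω v).normH ≤ Cg ∧
        ∀ a, 0 ≤ a → a ≤ Cα →
          energy D V β Ω (retraction (v - a • riemannianGrad D V β Ω v))
            ≤ energy D V β Ω v - a / 2 * (riemannianGrad D V β Ω v).normH ^ 2 := by
  obtain ⟨b, hb0, hb⟩ := exists_le_mul_norm_mul_norm B
  obtain ⟨c, hc0, hc⟩ := exists_le_mul_norm_mul_norm m
  have hB0 : ∀ v, 0 ≤ B v v := fun v => le_trans (by positivity) (hB v)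
  obtain ⟨Cu, hCu, hu⟩ : ∃ Cu : ℝ, 0 < Cu ∧
      ∀ v : H01 D, energy D V β Ω v ≤ E₀ → v.normH ≤ Cu := by
    refine ⟨√(2 / δ * E₀) + 1, by positivity, fun v hv => ?_⟩
    refine (Real.le_sqrt_of_sq_le ?_).trans (le_add_of_nonneg_right zero_le_one)
    have h1 : 0 ≤ β / 4 * ‖m v v‖ ^ 2 := by positivity
    rw [hE, quarticFunctional] at hv
    rw [div_mul_eq_mul_div, le_div_iff₀ hδ]
    linarith [hB v]
  obtain ⟨Cg, hCg, hg⟩ : ∃ Cg : ℝ, 0 < Cg ∧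
      ∀ v : H01 D, v.normH ≤ Cu → (sobolevGrad D V β Ω v).normH ≤ Cg := by
    refine ⟨(b * (κ * Cu) + β * c ^ 2 * (κ * Cu) ^ 3) * κ + 1, by positivity, fun v hv => ?_⟩
    have hvR : ‖v‖ ≤ κ * Cu := (hP v).trans (mul_le_mul_of_nonneg_left hv hκ.le)
    exact (normH_sobolevGrad_le hb0 hb hc0 hc hκ hP hβ hE hvR).trans
      (le_add_of_nonneg_right zero_le_one)
  obtain ⟨R, hR1, hR2⟩ : ∃ R : ℝ, κ * Cu ≤ R ∧ κ * Cg ≤ R :=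
    ⟨max (κ * Cu) (κ * Cg), le_max_left _ _, le_max_right _ _⟩
  obtain ⟨T, hT, hTeq⟩ : ∃ T : ℝ, 0 ≤ T ∧
      (1 / 2 * b + 11 / 4 * β * c ^ 2 * R ^ 2) * κ ^ 2 = T := ⟨_, by positivity, rfl⟩
  refine ⟨Cu, Cg, 1 / (2 * T + 1), hCu, hCg, by positivity,
    (div_le_one (by positivity)).2 (by linarith), fun v hv hvE => ?_⟩
  have hvu := hu v hvE
  refine ⟨hvu, hg v hvu, fun a ha haα => ?_⟩
  have haT : a * (2 * T + 1) ≤ 1 := (le_div_iff₀ (by positivity)).1 haα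
  have haT0 : 0 ≤ a * T := mul_nonneg ha hT
  refine energy_step hb0 hb hc0 hc hκ hP hβ hE hB0 hv (R := R) ?_ ha (by linarith) ?_ ?_
  · exact (hP v).trans ((mul_le_mul_of_nonneg_left hvu hκ.le).trans hR1)
  · exact (mul_le_mul_of_nonneg_left (hg v hvu) hκ.le).trans hR2
  · rw [hTeq]
    linarith

/-- The energy is bounded above on each sphere of `H₀¹(D)`. -/
theorem exists_energy_le_of_normH_eq (hP : ∀ u : H01 D, ‖u‖ ≤ κ * u.normH) (hβ : 0 ≤ β)
    (hE : energy D V β Ω = quarticFunctional B m β) (ρ : ℝ) :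
    ∃ E₀ : ℝ, ∀ v : H01 D, v.normH = ρ → energy D V β Ω v ≤ E₀ := by
  obtain ⟨b, hb0, hb⟩ := exists_le_mul_norm_mul_norm B
  obtain ⟨c, hc0, hc⟩ := exists_le_mul_norm_mul_norm m
  refine ⟨1 / 2 * (b * (κ * ρ) * (κ * ρ)) + β / 4 * (c * (κ * ρ) * (κ * ρ)) ^ 2, fun v hv => ?_⟩
  rw [hE]
  exact quarticFunctional_le hb0 hb hc0 hc hβ ((hP v).trans_eq (by rw [hv]))

end Dissipation

end GrossPitaevskii

end

theorem theorem3p1 (d : ℕ) [NeZero d] (hd : d = 2 ∨ d = 3)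
    (D : Set (GrossPitaevskii.Space d)) (hD_open : IsOpen D) (hD_bdd : Bornology.IsBounded D)
    (V : GrossPitaevskii.Space d → ℝ)
    (hV_bdd : MemLp V ⊤ (volume.restrict D))
    (hV_nonneg : ∀ᵐ r ∂(volume.restrict D), 0 ≤ V r)
    (β Ω : ℝ) (hβ : 0 ≤ β) (hΩ : 0 ≤ Ω)
    (hVΩ : ∃ K : ℝ, 0 < K ∧
      ∀ᵐ r ∂(volume.restrict D), (1 + K) / 4 * Ω ^ 2 * ((r 0) ^ 2 + (r 1) ^ 2) ≤ V r)
    (ρ : ℝ) :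
    ∃ Cu Cg Cα : ℝ, 0 < Cu ∧ 0 < Cg ∧ 0 < Cα ∧ Cα ≤ 1 ∧
      ∀ (αmin αmax : ℝ) (α : ℕ → ℝ) (u : ℕ → GrossPitaevskii.H01 D),
        0 < αmin → (∀ n, αmin ≤ α n) → (∀ n, α n ≤ αmax) → αmax ≤ Cα →
        (u 0).normH = ρ →
        GrossPitaevskii.IsH01Scheme D V β Ω α u →
        ∀ n : ℕ,
          (u n).normH ≤ Cu ∧
          ((GrossPitaevskii.riemannianGrad D V β Ω (u n)).normH
              ≤ (GrossPitaevskii.sobolevGrad D V β Ω (u n)).normH ∧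
            (GrossPitaevskii.sobolevGrad D V β Ω (u n)).normH ≤ Cg) ∧
          αmin / 2 * (GrossPitaevskii.riemannianGrad D V β Ω (u n)).normH ^ 2
            ≤ GrossPitaevskii.energy D V β Ω (u n)
              - GrossPitaevskii.energy D V β Ω (u (n + 1)) := by
  open GrossPitaevskii in
  obtain ⟨K, hK, hVK⟩ := hVΩ
  have hd2 : 2 ≤ d := by rcases hd with rfl | rfl <;> norm_num
  obtain ⟨κ, hκ, hP⟩ := exists_norm_le_normH hd hD_bdd
  obtain ⟨B, hB⟩ := exists_quadraticForm hD_bdd hD_open.measurableSet hV_bdd Ω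
  obtain ⟨m, hm⟩ := exists_productMap hd hD_bdd
  have hE : energy D V β Ω = quarticFunctional B m β := energy_eq hB hm
  have hcoer : ∀ v : H01 D, K / (1 + K) * v.normH ^ 2 ≤ B v v := fun v => by
    rw [(hB v).2]
    exact normH_sq_le_integral_quadraticDensity hd2 hΩ hK hVK (hB v).1
  obtain ⟨E₀, hE₀⟩ := exists_energy_le_of_normH_eq hP hβ hE ρ
  obtain ⟨Cu, Cg, Cα, hCu, hCg, hCα, hCα1, hC⟩ :=
    exists_dissipation_constants hκ hP hβ hE (by positivity) hcoer E₀
  refine ⟨Cu, Cg, Cα, hCu, hCg, hCα, hCα1, ?_⟩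
  intro αmin αmax α u hmin hα1 hα2 hmax hρ hu
  have hα0 : ∀ n, 0 ≤ α n := fun n => hmin.le.trans (hα1 n)
  have hstep : ∀ n, u n ∈ sphere D → energy D V β Ω (u n) ≤ E₀ →
      energy D V β Ω (u (n + 1))
        ≤ energy D V β Ω (u n) - α n / 2 * (riemannianGrad D V β Ω (u n)).normH ^ 2 := by
    intro n hn hnE
    rw [hu.2 n]
    exact (hC _ hn hnE).2.2 _ (hα0 n) ((hα2 n).trans hmax)
  -- The energy never leaves the sublevel set of the initial value, on which the constants depend.
  have hind : ∀ n, u n ∈ sphere D ∧ energy D V β Ω (u n) ≤ E₀ := by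
    intro n
    induction n with
    | zero => exact ⟨hu.1, hE₀ _ hρ⟩
    | succ n ih =>
      refine ⟨?_, (hstep n ih.1 ih.2).trans ((sub_le_self _ ?_).trans ih.2)⟩
      · rw [hu.2 n]
        refine retraction_mem_sphere (ne_of_gt ?_)
        have h1 : (u n).normL2 = 1 := ih.1
        exact (h1.symm ▸ one_pos).trans_le (normL2_le_normL2_sub_smul_tangentProj hκ hP (u n) _ _)
      · exact mul_nonneg (half_pos (hmin.trans_le (hα1 n))).le (sq_nonneg _)
  intro n
  obtain ⟨h1, h2, -⟩ := hC _ (hind n).1 (hind n).2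
  refine ⟨h1, ⟨normH_tangentProj_le _ _, h2⟩, ?_⟩
  refine le_trans ?_ (le_sub_comm.1 (hstep n (hind n).1 (hind n).2))
  exact mul_le_mul_of_nonneg_right (div_le_div_of_nonneg_right (hα1 n) zero_le_two) (sq_nonneg _)
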